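/- Let $d\ge 1$ be an integer and let $\beta,\mathcal L>0$. Let $\ell$ be the largest integer strictly smaller than $\beta$. The Hölder class $\mathcal H(\beta,\mathcal L)$ is the set of probability densities $\pi$ on $\mathbb R^d$ that are $\ell$ times continuously differentiable and whose $\ell$-th derivative satisfies $\|D^\ell\pi(x)-D^\ell\pi(y)\|\le \mathcal L\,|x-y|^{\beta-\ell}$ for all $x,y\in\mathbb R^d$ (Euclidean norm on $\mathbb R^d$, operator norm of $\ell$-linear forms). For $\alpha=(\alpha_1,\dots,\alpha_d)\in(0,\infty)^d$ and complete separable metric spaces $\mathcal Z^1,\dots,\mathcal Z^d$ with their Borel $\sigma$-fields, let $\mathcal Q_\alpha$ be the set of non-interactive mechanisms satisfying $\alpha$-componentwise local differential privacy ($\alpha$-CLDP), that is, of families $Q=(Q^1,\dots,Q^d)$ of Markov kernels $Q^j$ from $\mathbb R$ to $\mathcal Z^j$ such that $Q^j(A\mid x)\le e^{\alpha_j}Q^j(A\mid x')$ for all $j$, all $x,x'\in\mathbb R$ and all Borel sets $A\subseteq\mathcal Z^j$. Let $X_1,\dots,X_n$ be independent vectors in $\mathbb R^d$ with density $\pi$.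 Given $X_1,\dots,X_n$, the public variables $Z_i^j$ ($1\le i\le n$, $1\le j\le d$) are independent with $Z_i^j\sim Q^j(\cdot\mid X_i^j)$; write $Z_i=(Z_i^1,\dots,Z_i^d)$, and write $\mathbb E_{\pi,Q}$ for the expectation under the resulting law of $(Z_1,\dots,Z_n)$. Then for every $\kappa>0$ there is a constant $c>0$, depending only on $d,\beta,\mathcal L,\kappa$, such that for all $n\ge 1$, all $\alpha\in(0,\infty)^d$ with $n\prod_{j=1}^d(e^{\alpha_j}-1)^2\ge\kappa$, all $x_0\in\mathbb R^d$ and all such spaces $\mathcal Z^1,\dots,\mathcal Z^d$, $$\inf_{Q\in\mathcal Q_\alpha}\ \inf_{\tilde\pi}\ \sup_{\pi\in\mathcal H(\beta,\mathcal L)}\mathbb E_{\pi,Q}\big[|\tilde\pi(x_0)-\pi(x_0)|^2\big]\ \ge\ c\,\Big(n\prod_{j=1}^d(e^{\alpha_j}-1)^2\Big)^{-\frac{\beta}{\beta+d}},$$ where the infimum over $\tilde\pi$ is over all estimators $\tilde\pi(x_0)$ that are measurable real functions of $(Z_1,\dots,Z_n)$. In particular (taking $\kappa=\prod_j(e^{\alpha_j}-1)^2$),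 for each fixed $\alpha\in(0,\infty)^d$ the bound holds for all $n\ge1$ with a constant $c$ depending only on $d,\beta,\mathcal L,\alpha$. -/

import Mathlib

open MeasureTheory ProbabilityTheory

open scoped ENNReal

namespace CLDP

/-- The largest integer strictly smaller than `β` (for `β > 0`). -/
noncomputable def holderOrder (β : ℝ) : ℕ := ⌈β⌉₊ - 1

theorem holderOrder_spec {β : ℝ} (hβ : 0 < β) :
    (holderOrder β : ℝ) < β ∧ β ≤ (holderOrder β : ℝ) + 1 := by
  have h1 : 1 ≤ ⌈β⌉₊ := Nat.one_le_iff_ne_zero.2 (Nat.ceil_pos.2 hβ).ne'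
  have h2 : ((⌈β⌉₊ - 1 : ℕ) : ℝ) = (⌈β⌉₊ : ℝ) - 1 := by push_cast [h1]; ring
  have h3 := Nat.le_ceil β
  have h4 := Nat.ceil_lt_add_one hβ.le
  unfold holderOrder
  rw [h2]
  constructor <;> linarith

/-- The functions of the Hölder class on `ℝ^d` (with its Euclidean norm): `f` is `ℓ` times
continuously differentiable, where `ℓ` is the largest integer strictly smaller than `β`, and its
`ℓ`-th derivative is `(β - ℓ)`-Hölder with constant `L`. -/
def IsHolder {d : ℕ} (β L : ℝ) (f : EuclideanSpace ℝ (Fin d) → ℝ) : Prop :=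
  ContDiff ℝ (holderOrder β) f ∧
    ∀ x y : EuclideanSpace ℝ (Fin d),
      ‖iteratedFDeriv ℝ (holderOrder β) f x - iteratedFDeriv ℝ (holderOrder β) f y‖
        ≤ L * ‖x - y‖ ^ (β - (holderOrder β : ℝ))

/-- The Hölder class `H(β, L)` of probability densities on `ℝ^d`. -/
def holderDensities (d : ℕ) (β L : ℝ) : Set (EuclideanSpace ℝ (Fin d) → ℝ) :=
  {f | (∀ x, 0 ≤ f x) ∧ ∫⁻ x, ENNReal.ofReal (f x) = 1 ∧ IsHolder β L f}

/-- The probability law on `ℝ^d` with density `f`. -/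
noncomputable def densityLaw {d : ℕ} (f : EuclideanSpace ℝ (Fin d) → ℝ) :
    Measure (EuclideanSpace ℝ (Fin d)) :=
  volume.withDensity fun x => ENNReal.ofReal (f x)

/-- A non-interactive privacy mechanism satisfying `α`-componentwise local differential privacy
for raw data in `ℝ^d`: one Markov kernel `Q j` from `ℝ` to `Z j` for each component `j`, such that
`Q j (A | x) ≤ exp (α j) * Q j (A | x')` for all raw values `x, x'` and all measurable `A`. -/
structure Mechanism {d : ℕ} (α : Fin d → ℝ) (Z : Fin d → Type*) [∀ j, MeasurableSpace (Z j)] where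
  Q : ∀ j, Kernel ℝ (Z j)
  markov : ∀ j, IsMarkovKernel (Q j)
  isPrivate : ∀ (j : Fin d) (x x' : ℝ) (A : Set (Z j)), MeasurableSet A →
    Q j x A ≤ ENNReal.ofReal (Real.exp (α j)) * Q j x' A

section

variable {d : ℕ} {α : Fin d → ℝ} {Z : Fin d → Type*} [∀ j, MeasurableSpace (Z j)]

instance (K : Mechanism α Z) (j : Fin d) : IsMarkovKernel (K.Q j) := K.markov j

theorem Mechanism.measurable_pi (K : Mechanism α Z) :
    Measurable fun x : EuclideanSpace ℝ (Fin d) => Measure.pi fun j => K.Q j (x j) := by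
  refine Measurable.measure_of_isPiSystem_of_isProbabilityMeasure generateFrom_pi.symm
    isPiSystem_pi ?_
  rintro _ ⟨A, hA, rfl⟩
  simp only [Set.mem_univ_pi, Set.mem_ofPred_eq] at hA
  simp only [Measure.pi_pi]
  exact Finset.measurable_prod _ fun j _ => ((K.Q j).measurable_coe (hA j)).comp (by fun_prop)

/-- The kernel of the whole public vector `(Z^1, …, Z^d)` given the raw vector
`x = (x^1, …, x^d)`: the components are drawn independently, `Z^j` from `Q j (· | x^j)`. -/
noncomputable def Mechanism.channel (K : Mechanism α Z) :
    Kernel (EuclideanSpace ℝ (Fin d)) (∀ j, Z j) where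
  toFun x := Measure.pi fun j => K.Q j (x j)
  measurable' := K.measurable_pi

/-- The law of the public sample `(Z_1, …, Z_n)` when the raw vectors `X_1, …, X_n` are
independent with density `f`. -/
noncomputable def Mechanism.publicLaw (K : Mechanism α Z) (n : ℕ)
    (f : EuclideanSpace ℝ (Fin d) → ℝ) : Measure (Fin n → ∀ j, Z j) :=
  Measure.pi fun _ : Fin n => (densityLaw f).bind K.channel

end

/-- The `α`-CLDP minimax pointwise quadratic risk at `x₀` over `H(β, L)`, from `n` public vectors
with values in `∏ j, Z j`, with the infimum over all non-interactive mechanisms and all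
(measurable) estimators `T` of `π(x₀)`. -/
noncomputable def minimaxRisk {d : ℕ} (α : Fin d → ℝ) (Z : Fin d → Type*)
    [∀ j, MeasurableSpace (Z j)] (β L : ℝ) (n : ℕ) (x₀ : EuclideanSpace ℝ (Fin d)) : ℝ≥0∞ :=
  ⨅ (K : Mechanism α Z) (T : (Fin n → ∀ j, Z j) → ℝ) (_ : Measurable T),
    ⨆ f ∈ holderDensities d β L,
      ∫⁻ z, ENNReal.ofReal ((T z - f x₀) ^ 2) ∂(K.publicLaw n f)

end CLDP

/-!
The bound is Le Cam's two-point method with a perturbation of tensor-product form.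

Fix a smooth compactly supported density spread widely around `x₀`, flat near `x₀`
(`exists_contDiff_density_const_on_ball`), and add to it a bump `a ∏ j, φ((x_j - x₀_j) / h)` with
`φ(0) = 1`, `∫ φ = 0` and `a` of order `h^β`. Both densities lie in the Hölder class
(`exists_two_densities`) and they differ by order `h^β` at `x₀`.

Since each factor of the bump integrates to zero, the public law of one vector only sees it through
the product over `j` of the fluctuations of `Q j (· | x)` around any fixed measure. The right choice
is the largest measure `floor j` below all the `Q j (· | x)`: privacy gives
`floor j ≤ Q j (· | x) ≤ e^{α_j} floor j` (`Mechanism.le_smul_floor`). Hence on boxes the two laws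
`P₀`, `P₁` of one public vector satisfy `|P₁ - P₀| ≤ δ P₀` with `δ` of order
`h^{β + d} ∏ j, (e^{α_j} - 1)` (`Mechanism.abs_real_box_sub_le`). Boxes form a semiring generating
the product σ-algebra, so this domination holds for all measurable sets
(`le_of_forall_measurable_box`), and the likelihood ratio has second moment at most `1 + δ²`, hence
at most `exp (n δ²)` for `n` independent vectors.

The inequality `two_point_lower_bound` bounds the sum of the two quadratic risks from below by the
squared separation over `1 + exp (n δ²)`. Taking `h` proportional to
`(n ∏ j, (e^{α_j} - 1)²)^{-1 / (2 (β + d))}` keeps `n δ²` constant and gives the rate; the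
assumption on `κ` keeps `h` bounded, so that the bump stays in the flat region of the base density.
-/

namespace CLDP

/-! ### Hölder bounds for rescaled bumps -/

open scoped ContDiff

/-- Derivatives of a smooth compactly supported function are Lipschitz, which gives the Hölder bound
at distances below `1`, and bounded, which gives it at distances above `1`. -/
theorem exists_norm_iteratedFDeriv_sub_le_rpow {E : Type*} [NormedAddCommGroup E]
    [NormedSpace ℝ E] {f : E → ℝ} (hf : ContDiff ℝ ∞ f) (hc : HasCompactSupport f) (k : ℕ)
    {θ : ℝ} (hθ0 : 0 ≤ θ) (hθ1 : θ ≤ 1) :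
    ∃ C : ℝ, 0 ≤ C ∧ ∀ x y : E,
      ‖iteratedFDeriv ℝ k f x - iteratedFDeriv ℝ k f y‖ ≤ C * ‖x - y‖ ^ θ := by
  have h1 : ContDiff ℝ 1 (iteratedFDeriv ℝ k f) :=
    hf.iteratedFDeriv_right (m := 1) (i := k) (by exact_mod_cast le_top)
  have h2 : HasCompactSupport (iteratedFDeriv ℝ k f) := hc.iteratedFDeriv k
  obtain ⟨K, hK⟩ := h1.lipschitzWith_of_hasCompactSupport h2 one_ne_zero
  obtain ⟨M, hM⟩ := h2.exists_bound_of_continuous h1.continuous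
  have hM0 : 0 ≤ M := (norm_nonneg _).trans (hM 0)
  refine ⟨K + 2 * M, by positivity, fun x y => ?_⟩
  have hn := norm_nonneg (x - y)
  have hp : 0 ≤ ‖x - y‖ ^ θ := Real.rpow_nonneg hn θ
  rcases le_total ‖x - y‖ 1 with h | h
  · have h3 : ‖x - y‖ ≤ ‖x - y‖ ^ θ := by
      rcases hn.eq_or_lt with h0 | h0
      · rw [← h0]; exact Real.rpow_nonneg le_rfl θ
      · simpa using Real.rpow_le_rpow_of_exponent_ge h0 h hθ1
    calc _ ≤ K * ‖x - y‖ := hK.norm_sub_le x y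
      _ ≤ K * ‖x - y‖ ^ θ := by gcongr
      _ ≤ _ := by nlinarith
  · have h3 : 1 ≤ ‖x - y‖ ^ θ := Real.one_le_rpow h hθ0
    calc _ ≤ ‖iteratedFDeriv ℝ k f x‖ + ‖iteratedFDeriv ℝ k f y‖ := norm_sub_le _ _
      _ ≤ 2 * M := by linarith [hM x, hM y]
      _ ≤ 2 * M * ‖x - y‖ ^ θ := by nlinarith
      _ ≤ _ := by nlinarith [K.2, mul_nonneg K.2 hp]

theorem iteratedFDeriv_const_mul_comp_smul_sub {E : Type*} [NormedAddCommGroup E]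
    [NormedSpace ℝ E] {f : E → ℝ} (hf : ContDiff ℝ ∞ f) (k : ℕ) (a r : ℝ) (x₀ x : E) :
    iteratedFDeriv ℝ k (fun y => a * f (r • (y - x₀))) x
      = (a * r ^ k) • iteratedFDeriv ℝ k f (r • (x - x₀)) := by
  have hk : ∀ {g : E → ℝ}, ContDiff ℝ ∞ g → ContDiff ℝ k g :=
    fun hg => hg.of_le (by exact_mod_cast le_top)
  have h1 : iteratedFDeriv ℝ k (fun y => f (r • y)) (x - x₀)
      = r ^ k • iteratedFDeriv ℝ k f (r • (x - x₀)) := by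
    have := (r • ContinuousLinearMap.id ℝ E).iteratedFDeriv_comp_right (hk hf) (x - x₀)
      (i := k) le_rfl
    have h2 : (f ∘ (r • ContinuousLinearMap.id ℝ E)) = fun y => f (r • y) := by ext; simp
    rw [h2] at this
    rw [this]
    ext m
    simp [ContinuousMultilinearMap.map_smul_univ]
  have h3 : ContDiff ℝ ∞ (fun y => f (r • (y - x₀))) := hf.comp (by fun_prop)
  have h4 := iteratedFDeriv_const_smul_apply (𝕜 := ℝ) (i := k) (a := a) (x := x)
    (hk h3).contDiffAt
  have h5 : (fun y => a * f (r • (y - x₀))) = a • fun y => f (r • (y - x₀)) := by ext; simp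
  rw [h5, h4, iteratedFDeriv_comp_sub (f := fun y => f (r • y)), h1, smul_smul]

/-- A scaled and translated bump `a f((x - x₀) / h)` is Hölder with constant `a h^{-β}` times that
of `f`. -/
theorem norm_iteratedFDeriv_scaled_sub_le {E : Type*} [NormedAddCommGroup E]
    [NormedSpace ℝ E] {f : E → ℝ} (hf : ContDiff ℝ ∞ f) {k : ℕ} {β C a h : ℝ}
    (hC : ∀ x y : E,
      ‖iteratedFDeriv ℝ k f x - iteratedFDeriv ℝ k f y‖ ≤ C * ‖x - y‖ ^ (β - (k : ℝ)))
    (ha : 0 ≤ a) (hh : 0 < h) (x₀ x y : E) :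
    ‖iteratedFDeriv ℝ k (fun y => a * f (h⁻¹ • (y - x₀))) x
        - iteratedFDeriv ℝ k (fun y => a * f (h⁻¹ • (y - x₀))) y‖
      ≤ a * h ^ (-β) * C * ‖x - y‖ ^ (β - (k : ℝ)) := by
  rw [iteratedFDeriv_const_mul_comp_smul_sub hf, iteratedFDeriv_const_mul_comp_smul_sub hf,
    ← smul_sub, norm_smul, Real.norm_of_nonneg (by positivity)]
  have h1 := hC (h⁻¹ • (x - x₀)) (h⁻¹ • (y - x₀))
  have h2 : h⁻¹ • (x - x₀) - h⁻¹ • (y - x₀) = h⁻¹ • (x - y) := by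
    rw [← smul_sub]; congr 1; abel
  rw [h2, norm_smul, Real.norm_of_nonneg (by positivity),
    Real.mul_rpow (by positivity) (norm_nonneg _)] at h1
  have h3 : h⁻¹ ^ k * h⁻¹ ^ (β - (k : ℝ)) = h ^ (-β) := by
    rw [← Real.rpow_natCast, ← Real.rpow_add (by positivity), add_sub_cancel,
      Real.inv_rpow hh.le, Real.rpow_neg hh.le]
  calc _ ≤ a * h⁻¹ ^ k * (C * (h⁻¹ ^ (β - (k : ℝ)) * ‖x - y‖ ^ (β - (k : ℝ)))) := by gcongr
    _ = a * (h⁻¹ ^ k * h⁻¹ ^ (β - (k : ℝ))) * C * ‖x - y‖ ^ (β - (k : ℝ)) := by ring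
    _ = _ := by rw [h3]

/-- The difference of a bump and of a disjoint translate of it integrates to zero. -/
theorem exists_contDiff_integral_eq_zero :
    ∃ φ : ℝ → ℝ, ContDiff ℝ ∞ φ ∧ HasCompactSupport φ ∧ ∫ x, φ x = 0 ∧ φ 0 = 1 ∧
      ∀ x, |φ x| ≤ 1 := by
  let ψ : ContDiffBump (0 : ℝ) := ⟨1, 2, one_pos, one_lt_two⟩
  have hs : ContDiff ℝ ∞ ψ := ψ.contDiff
  have hs' : ContDiff ℝ ∞ fun x => ψ (x - 3) := hs.comp (by fun_prop)
  have hc' : HasCompactSupport fun x => ψ (x - 3) := 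
    ψ.hasCompactSupport.comp_homeomorph (Homeomorph.subRight (3 : ℝ))
  refine ⟨fun x => ψ x - ψ (x - 3), hs.sub hs', ψ.hasCompactSupport.sub hc', ?_, ?_, ?_⟩
  · rw [integral_sub ψ.integrable (hs'.continuous.integrable_of_hasCompactSupport hc'),
      integral_sub_right_eq_self (fun x => ψ x) 3, sub_self]
  · have h1 : ψ 0 = 1 := ψ.one_of_mem_closedBall (by simp [ψ])
    have h2 : ψ (0 - 3) = 0 := ψ.zero_of_le_dist (by simp [ψ]; norm_num)
    simp only [h1, h2, sub_zero]
  · intro x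
    rw [abs_le]
    constructor <;> linarith [ψ.nonneg (x := x), ψ.nonneg (x := x - 3), ψ.le_one (x := x),
      ψ.le_one (x := x - 3)]

/-- The tensor product of a function of one real variable over the coordinates of `ℝ^d`. -/
noncomputable def tensorBump (d : ℕ) (φ : ℝ → ℝ) (x : EuclideanSpace ℝ (Fin d)) : ℝ :=
  ∏ j, φ (x j)

theorem contDiff_tensorBump {d : ℕ} {φ : ℝ → ℝ} (hφ : ContDiff ℝ ∞ φ) :
    ContDiff ℝ ∞ (tensorBump d φ) := by
  refine contDiff_prod fun j _ => hφ.comp ?_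
  fun_prop

theorem hasCompactSupport_tensorBump {d : ℕ} {φ : ℝ → ℝ} (hφ : HasCompactSupport φ) :
    HasCompactSupport (tensorBump d φ) := by
  refine HasCompactSupport.intro ((isCompact_univ_pi fun _ : Fin d => hφ.isCompact).image
    (PiLp.continuous_toLp 2 _)) fun x hx => ?_
  by_contra hne
  refine hx ⟨WithLp.ofLp x, fun j _ => subset_tsupport _ ?_, rfl⟩
  exact Finset.prod_ne_zero_iff.1 hne j (Finset.mem_univ j)

theorem abs_tensorBump_le_one {d : ℕ} {φ : ℝ → ℝ} (hφ : ∀ x, |φ x| ≤ 1)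
    (x : EuclideanSpace ℝ (Fin d)) : |tensorBump d φ x| ≤ 1 := by
  rw [tensorBump, Finset.abs_prod]
  exact Finset.prod_le_one (fun _ _ => abs_nonneg _) fun _ _ => hφ _

/-! ### Domination of measures, likelihood ratios and the two-point inequality -/

theorem isSetSemiring_measurable_boxes {ι : Type*} [Fintype ι] [Nonempty ι]
    {Z : ι → Type*} [∀ i, MeasurableSpace (Z i)] :
    IsSetSemiring (Set.pi Set.univ '' Set.pi Set.univ fun i => {s : Set (Z i) | MeasurableSet s})
    where
  empty_mem := ⟨fun _ => ∅, fun _ _ => MeasurableSet.empty, by simp⟩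
  inter_mem := by
    rintro _ ⟨s, hs, rfl⟩ _ ⟨t, ht, rfl⟩
    exact ⟨fun i => s i ∩ t i, fun i hi => MeasurableSet.inter (hs i hi) (ht i hi),
      Set.pi_inter_distrib⟩
  sdiff_eq_sUnion' := by
    classical
    rintro _ ⟨s, hs, rfl⟩ _ ⟨t, ht, rfl⟩
    -- The points of the difference of two boxes are sorted by the nonempty set `P` of coordinates
    -- at which they leave `t`; each class is a box.
    let B : Finset ι → Set (∀ i, Z i) := fun P =>
      Set.univ.pi fun i => if i ∈ P then s i \ t i else s i ∩ t i
    have hB : ∀ P x, x ∈ B P ↔ (∀ i, x i ∈ s i) ∧ ∀ i, i ∈ P ↔ x i ∉ t i := by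
      intro P x
      simp only [B, Set.mem_univ_pi]
      rw [← forall_and]
      refine forall_congr' fun i => ?_
      by_cases h : i ∈ P <;> simp [h]
    refine ⟨(Finset.univ.filter Finset.Nonempty).image B, ?_, ?_, ?_⟩
    · intro A hA
      simp only [Finset.coe_image, Set.mem_image] at hA
      obtain ⟨P, -, rfl⟩ := hA
      refine ⟨_, fun i hi => ?_, rfl⟩
      by_cases h : i ∈ P
      · simpa [h] using MeasurableSet.diff (hs i hi) (ht i hi)
      · simpa [h] using MeasurableSet.inter (hs i hi) (ht i hi)
    · intro A hA A' hA' hne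
      simp only [Finset.coe_image, Set.mem_image] at hA hA'
      obtain ⟨P, -, rfl⟩ := hA
      obtain ⟨P', -, rfl⟩ := hA'
      refine Set.disjoint_left.2 fun x hx hx' => hne ?_
      congr 1
      ext i
      rw [((hB _ _).1 hx).2 i, ((hB _ _).1 hx').2 i]
    · ext x
      simp only [Finset.coe_image, Set.sUnion_image, Set.mem_iUnion, exists_prop, hB]
      constructor
      · rintro ⟨h1, h2⟩
        simp only [Set.mem_univ_pi, not_forall] at h1 h2
        obtain ⟨i, hi⟩ := h2
        exact ⟨Finset.univ.filter fun i => x i ∉ t i, by simpa using ⟨i, by simpa using hi⟩, h1,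
          by simp⟩
      · rintro ⟨P, hP, h1, h2⟩
        simp only [Finset.coe_filter, Finset.mem_univ, true_and, Set.mem_ofPred_eq] at hP
        obtain ⟨i, hi⟩ := hP
        exact ⟨by simpa using h1, fun h => (h2 i).1 hi (h i (Set.mem_univ i))⟩

/-- Domination of one finite measure by another can be tested on a generating semiring. (A
generating π-system does not suffice for an inequality.) -/
theorem le_of_forall_mem_isSetSemiring {Ω : Type*} [mΩ : MeasurableSpace Ω] {μ ν : Measure Ω}
    [IsFiniteMeasure μ] [IsFiniteMeasure ν] {C : Set (Set Ω)} (hC : IsSetSemiring C)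
    (hgen : mΩ = MeasurableSpace.generateFrom C) (huniv : Set.univ ∈ C)
    (h : ∀ s ∈ C, μ s ≤ ν s) : μ ≤ ν := by
  have hmeas : ∀ s ∈ C, MeasurableSet s := fun s hs => by
    rw [hgen]; exact MeasurableSpace.measurableSet_generateFrom hs
  have hsup : ∀ s ∈ supClosure C, MeasurableSet s ∧ μ s ≤ ν s := by
    intro s hs
    obtain ⟨P, hP⟩ := hC.mem_supClosure_iff.1 hs
    have hPm : ∀ t ∈ P.parts, MeasurableSet t := fun t ht => hmeas t (hP ht)
    have hdisj : (P.parts : Set (Set Ω)).PairwiseDisjoint id :=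
      Finset.supIndep_iff_pairwiseDisjoint.1 P.supIndep
    have hs' : s = ⋃ t ∈ P.parts, id t := by
      conv_lhs => rw [← P.sup_parts, Finset.sup_eq_iSup]
      rfl
    refine ⟨hs' ▸ Finset.measurableSet_biUnion _ hPm, ?_⟩
    rw [hs', measure_biUnion_finset hdisj hPm, measure_biUnion_finset hdisj hPm]
    exact Finset.sum_le_sum fun t ht => h t (hP ht)
  refine Measure.le_iff.2 fun s hs => ?_
  refine ENNReal.le_of_forall_pos_le_add fun ε hε _ => ?_
  have hε2 : (0 : ℝ≥0∞) < (ε / 2 : NNReal) := by exact_mod_cast half_pos hε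
  obtain ⟨t, htC, ht⟩ := exists_measure_symmDiff_lt_of_generateFrom_isSetSemiring (μ := μ + ν) hC
    ⟨{Set.univ}, Set.countable_singleton _, by simpa using huniv, by simp⟩ hgen hs hε2
  rw [Measure.add_apply] at ht
  calc μ s ≤ μ t + μ (symmDiff t s) := by
        refine (measure_mono fun x hx => ?_).trans (measure_union_le _ _)
        by_cases hxt : x ∈ t
        · exact Or.inl hxt
        · exact Or.inr (Or.inr ⟨hx, hxt⟩)
    _ ≤ ν t + μ (symmDiff t s) := add_le_add_left (hsup t htC).2 _
    _ ≤ (ν s + ν (symmDiff t s)) + μ (symmDiff t s) := by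
        gcongr
        refine (measure_mono fun x hx => ?_).trans (measure_union_le _ _)
        by_cases hxs : x ∈ s
        · exact Or.inl hxs
        · exact Or.inr (Or.inl ⟨hx, hxs⟩)
    _ ≤ ν s + (((ε / 2 : NNReal) : ℝ≥0∞) + ((ε / 2 : NNReal) : ℝ≥0∞)) := by
        rw [add_assoc]
        gcongr
        · exact le_add_self.trans ht.le
        · exact le_self_add.trans ht.le
    _ = ν s + ε := by rw [← ENNReal.coe_add, add_halves]

theorem le_of_forall_measurable_box {ι : Type*} [Fintype ι] [Nonempty ι] {Z : ι → Type*}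
    [∀ i, MeasurableSpace (Z i)] {μ ν : Measure (∀ i, Z i)} [IsFiniteMeasure μ]
    [IsFiniteMeasure ν]
    (h : ∀ A : ∀ i, Set (Z i), (∀ i, MeasurableSet (A i)) →
      μ (Set.univ.pi A) ≤ ν (Set.univ.pi A)) : μ ≤ ν := by
  refine le_of_forall_mem_isSetSemiring isSetSemiring_measurable_boxes generateFrom_pi.symm
    ⟨fun _ => Set.univ, fun _ _ => MeasurableSet.univ, by simp⟩ ?_
  rintro _ ⟨A, hA, rfl⟩
  exact h A fun i => hA i (Set.mem_univ i)

theorem lintegral_pi_prod {ι Ω : Type*} [Fintype ι] [MeasurableSpace Ω] (μ : Measure Ω)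
    [IsProbabilityMeasure μ] {g : ι → Ω → ℝ≥0∞} (hg : ∀ i, Measurable (g i)) :
    ∫⁻ z, ∏ i, g i (z i) ∂(Measure.pi fun _ : ι => μ) = ∏ i, ∫⁻ x, g i x ∂μ := by
  have h := lintegral_prod_eq_prod_lintegral_of_indepFun (μ := Measure.pi fun _ : ι => μ)
    Finset.univ (fun i z => g i (z i))
    (iIndepFun_pi (fun i => (hg i).aemeasurable)) (fun i => (hg i).comp (measurable_pi_apply i))
  rw [h]
  refine Finset.prod_congr rfl fun i _ => ?_
  exact (measurePreserving_eval (fun _ : ι => μ) i).lintegral_comp (hg i)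

theorem pi_withDensity_eq {ι Ω : Type*} [Fintype ι] [MeasurableSpace Ω] (μ : Measure Ω)
    [IsProbabilityMeasure μ] {u : Ω → ℝ≥0∞} (hu : Measurable u)
    [SigmaFinite (μ.withDensity u)] :
    (Measure.pi fun _ : ι => μ.withDensity u)
      = (Measure.pi fun _ : ι => μ).withDensity fun z => ∏ i, u (z i) := by
  classical
  refine Measure.pi_eq fun s hs => ?_
  rw [withDensity_apply _ (MeasurableSet.univ_pi hs),
    ← lintegral_indicator (MeasurableSet.univ_pi hs)]
  have h : ∀ z : ι → Ω, (Set.univ.pi s).indicator (fun z => ∏ i, u (z i)) z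
      = ∏ i, (s i).indicator u (z i) := by
    intro z
    by_cases hz : z ∈ Set.univ.pi s
    · rw [Set.indicator_of_mem hz]
      exact Finset.prod_congr rfl fun i _ => (Set.indicator_of_mem (hz i (Set.mem_univ i)) _).symm
    · rw [Set.indicator_of_notMem hz]
      simp only [Set.mem_univ_pi, not_forall] at hz
      obtain ⟨i, hi⟩ := hz
      exact (Finset.prod_eq_zero (Finset.mem_univ i) (Set.indicator_of_notMem hi _)).symm
  simp_rw [h]
  rw [lintegral_pi_prod μ fun i => hu.indicator (hs i)]
  refine Finset.prod_congr rfl fun i _ => ?_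
  rw [lintegral_indicator (hs i), withDensity_apply _ (hs i)]

/-- Two probability measures that differ by at most `δ P₀` setwise have a likelihood ratio with
second moment at most `1 + δ²`, i.e. `χ²`-divergence at most `δ²`. -/
theorem exists_withDensity_eq_lintegral_sq_le {Ω : Type*} [MeasurableSpace Ω] {P₀ P₁ : Measure Ω}
    [IsProbabilityMeasure P₀] [IsProbabilityMeasure P₁] {δ : ℝ} (hδ : 0 ≤ δ)
    (h₁ : P₁ ≤ P₀ + ENNReal.ofReal δ • P₀) (h₀ : P₀ ≤ P₁ + ENNReal.ofReal δ • P₀) :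
    ∃ u : Ω → ℝ≥0∞, Measurable u ∧ P₁ = P₀.withDensity u ∧
      ∫⁻ x, u x ^ 2 ∂P₀ ≤ ENNReal.ofReal (1 + δ ^ 2) := by
  have hac : P₁ ≪ P₀ := by
    refine Measure.AbsolutelyContinuous.mk fun s _ hs => ?_
    have := h₁ s
    simpa [hs] using this
  have hu : Measurable (P₁.rnDeriv P₀) := Measure.measurable_rnDeriv _ _
  have hd : P₁ = P₀.withDensity (P₁.rnDeriv P₀) := (Measure.withDensity_rnDeriv_eq _ _ hac).symm
  have hint : ∀ s, MeasurableSet s → ∫⁻ x in s, P₁.rnDeriv P₀ x ∂P₀ = P₁ s :=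
    fun s hs => by rw [← withDensity_apply _ hs, ← hd]
  refine ⟨P₁.rnDeriv P₀, hu, hd, ?_⟩
  have hle1 : P₁.rnDeriv P₀ ≤ᵐ[P₀] fun _ => 1 + ENNReal.ofReal δ := by
    refine ae_le_of_forall_setLIntegral_le_of_sigmaFinite hu fun s hs _ => ?_
    rw [hint s hs, setLIntegral_const, add_mul, one_mul]
    simpa using h₁ s
  have hle2 : (fun _ => 1) ≤ᵐ[P₀] fun x => P₁.rnDeriv P₀ x + ENNReal.ofReal δ := by
    refine ae_le_of_forall_setLIntegral_le_of_sigmaFinite measurable_const fun s hs _ => ?_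
    rw [lintegral_add_right _ measurable_const, hint s hs, setLIntegral_const, setLIntegral_const,
      one_mul]
    simpa using h₀ s
  have hpt : ∀ᵐ x ∂P₀, P₁.rnDeriv P₀ x ^ 2 + 1
      ≤ 2 * P₁.rnDeriv P₀ x + ENNReal.ofReal (δ ^ 2) := by
    filter_upwards [hle1, hle2, Measure.rnDeriv_lt_top P₁ P₀] with x hx1 hx2 hx
    lift P₁.rnDeriv P₀ x to NNReal using hx.ne with v
    have e1 : (v : ℝ) ≤ 1 + δ := by
      have := ENNReal.toReal_mono (by finiteness) hx1
      rwa [ENNReal.toReal_add (by finiteness) (by finiteness), ENNReal.toReal_ofReal hδ] at this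
    have e2 : 1 ≤ (v : ℝ) + δ := by
      have := ENNReal.toReal_mono (by finiteness) hx2
      rwa [ENNReal.toReal_add (by finiteness) (by finiteness), ENNReal.toReal_ofReal hδ] at this
    have e3 : (v : ℝ) ^ 2 + 1 ≤ 2 * v + δ ^ 2 := by
      nlinarith [mul_nonneg (sub_nonneg.2 e1) (sub_nonneg.2 e2)]
    rw [← ENNReal.toReal_le_toReal (by finiteness) (by finiteness),
      ENNReal.toReal_add (by finiteness) (by finiteness),
      ENNReal.toReal_add (by finiteness) (by finiteness), ENNReal.toReal_ofReal (sq_nonneg δ)]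
    simpa using e3
  have hI := lintegral_mono_ae hpt
  have hone : ∫⁻ x, P₁.rnDeriv P₀ x ∂P₀ = 1 := by
    have := hint Set.univ MeasurableSet.univ
    simpa using this
  rw [lintegral_add_right _ measurable_const, lintegral_add_right _ measurable_const,
    lintegral_const_mul _ hu, hone] at hI
  simp only [lintegral_const, measure_univ, mul_one] at hI
  have h2 : (2 : ℝ≥0∞) + ENNReal.ofReal (δ ^ 2) = ENNReal.ofReal (1 + δ ^ 2) + 1 := by
    rw [ENNReal.ofReal_add zero_le_one (sq_nonneg δ), ENNReal.ofReal_one, ← one_add_one_eq_two]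
    ring
  rw [h2] at hI
  exact (ENNReal.add_le_add_iff_right ENNReal.one_ne_top).1 hI

/-- Le Cam's two-point inequality in `χ²` form: if `P₁` has likelihood ratio `U` with respect to
`P₀` and `E₀ U² ≤ B`, then no estimator has small quadratic risk at both `a` and `b`. -/
theorem two_point_lower_bound {Ω : Type*} [MeasurableSpace Ω] {P₀ P₁ : Measure Ω}
    {U : Ω → ℝ≥0∞} (hU : Measurable U) (h₁ : P₁ = P₀.withDensity U)
    [IsProbabilityMeasure P₁] {B : ℝ} (hB : 0 ≤ B) (hUB : ∫⁻ x, U x ^ 2 ∂P₀ ≤ ENNReal.ofReal B)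
    {T : Ω → ℝ} (hT : Measurable T) (a b : ℝ) :
    ENNReal.ofReal ((b - a) ^ 2 / (1 + B))
      ≤ ∫⁻ x, ENNReal.ofReal ((T x - a) ^ 2) ∂P₀ + ∫⁻ x, ENNReal.ofReal ((T x - b) ^ 2) ∂P₁ := by
  set t : ℝ := 1 / (1 + B) with ht
  have ht0 : 0 < t := by positivity
  set D : ℝ := (b - a) ^ 2 with hD
  have hD0 : 0 ≤ D := sq_nonneg _
  have hU1 : ∫⁻ x, U x ∂P₀ = 1 := by
    have : P₁ Set.univ = 1 := measure_univ
    simpa [h₁] using this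
  have hfin : ∀ᵐ x ∂P₀, U x < ⊤ := ae_lt_top hU (by rw [hU1]; exact ENNReal.one_ne_top)
  -- The elementary inequality `p² + v q² ≥ (p - q)² v / (1 + v)`, linearised through
  -- `1 / (1 + v) ≥ 2 t - t² (1 + v)`; the value of `t` optimises the integrated bound.
  have hpt : ∀ᵐ x ∂P₀, ENNReal.ofReal (2 * t * D) * U x
      ≤ ENNReal.ofReal ((T x - a) ^ 2) + U x * ENNReal.ofReal ((T x - b) ^ 2)
        + ENNReal.ofReal (t ^ 2 * D) * (U x + U x ^ 2) := by
    filter_upwards [hfin] with x hx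
    lift U x to NNReal using hx.ne with v
    have hv : (0 : ℝ) ≤ v := v.2
    have key : 2 * t * D * v
        ≤ (T x - a) ^ 2 + v * (T x - b) ^ 2 + t ^ 2 * D * (v + v ^ 2) := by
      have hsq : 0 ≤ ((T x - a) + v * (T x - b)) ^ 2 + v * D * (1 - t * (1 + v)) ^ 2 := by
        positivity
      have hmul : ((T x - a) + v * (T x - b)) ^ 2 + v * D * (1 - t * (1 + v)) ^ 2
          = (1 + v) * ((T x - a) ^ 2 + v * (T x - b) ^ 2 + t ^ 2 * D * (v + v ^ 2)
            - 2 * t * D * v) := by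
        rw [hD]; ring
      rw [hmul] at hsq
      have := nonneg_of_mul_nonneg_right hsq (by positivity)
      linarith
    have hv' : (v : ℝ≥0∞) = ENNReal.ofReal v := by simp
    rw [hv', ← ENNReal.ofReal_pow hv, ← ENNReal.ofReal_mul (by positivity),
      ← ENNReal.ofReal_mul hv, ← ENNReal.ofReal_add hv (by positivity),
      ← ENNReal.ofReal_mul (by positivity), ← ENNReal.ofReal_add (by positivity) (by positivity),
      ← ENNReal.ofReal_add (by positivity) (by positivity)]
    exact ENNReal.ofReal_le_ofReal key
  have hma : Measurable fun x => ENNReal.ofReal ((T x - a) ^ 2) :=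
    ((hT.sub_const a).pow_const 2).ennreal_ofReal
  have hmb : Measurable fun x => ENNReal.ofReal ((T x - b) ^ 2) :=
    ((hT.sub_const b).pow_const 2).ennreal_ofReal
  have hI := lintegral_mono_ae hpt
  rw [lintegral_const_mul _ hU, hU1, mul_one,
    lintegral_add_right _ (by fun_prop), lintegral_add_left hma,
    lintegral_const_mul _ (by fun_prop), lintegral_add_left hU, hU1] at hI
  have hP1 : ∫⁻ x, ENNReal.ofReal ((T x - b) ^ 2) ∂P₁
      = ∫⁻ x, U x * ENNReal.ofReal ((T x - b) ^ 2) ∂P₀ := by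
    rw [h₁, lintegral_withDensity_eq_lintegral_mul _ hU hmb]; rfl
  rw [← hP1] at hI
  have hlast : ENNReal.ofReal (t ^ 2 * D) * (1 + ∫⁻ x, U x ^ 2 ∂P₀)
      ≤ ENNReal.ofReal (t * D) := by
    calc _ ≤ ENNReal.ofReal (t ^ 2 * D) * (1 + ENNReal.ofReal B) := by gcongr
      _ = ENNReal.ofReal (t * D) := by
        rw [← ENNReal.ofReal_one, ← ENNReal.ofReal_add zero_le_one hB,
          ← ENNReal.ofReal_mul (by positivity)]
        congr 1
        rw [ht]; field_simp
  have hsplit : ENNReal.ofReal (2 * t * D)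
      = ENNReal.ofReal (D / (1 + B)) + ENNReal.ofReal (t * D) := by
    rw [← ENNReal.ofReal_add (by positivity) (by positivity)]
    congr 1
    rw [ht]; ring
  rw [hsplit] at hI
  exact (ENNReal.add_le_add_iff_right ENNReal.ofReal_ne_top).1 (hI.trans (by gcongr))

/-! ### Information passing through a private mechanism -/

/-- The largest measure below all the laws `Q j (· | x)`: the part of the `j`-th public variable
that carries no information about the raw value. -/
noncomputable def Mechanism.floor {d : ℕ} {α : Fin d → ℝ} {Z : Fin d → Type*}
    [∀ j, MeasurableSpace (Z j)] (K : Mechanism α Z) (j : Fin d) : Measure (Z j) :=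
  ⨅ x, K.Q j x

section

variable {d : ℕ} {α : Fin d → ℝ} {Z : Fin d → Type*} [∀ j, MeasurableSpace (Z j)]

theorem Mechanism.floor_le (K : Mechanism α Z) (j : Fin d) (x : ℝ) : K.floor j ≤ K.Q j x :=
  iInf_le _ x

instance (K : Mechanism α Z) (j : Fin d) : IsFiniteMeasure (K.floor j) :=
  isFiniteMeasure_of_le _ (K.floor_le j 0)

/-- Privacy reads `e^{-α} Q(· | x) ≤ Q(· | x')` for all `x'`, hence the left side is below the
infimum. -/
theorem Mechanism.le_smul_floor (K : Mechanism α Z) (j : Fin d) (x : ℝ) :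
    K.Q j x ≤ ENNReal.ofReal (Real.exp (α j)) • K.floor j := by
  have hc0 : ENNReal.ofReal (Real.exp (α j)) ≠ 0 := by simp [Real.exp_pos]
  have h : (ENNReal.ofReal (Real.exp (α j)))⁻¹ • K.Q j x ≤ K.floor j := by
    refine le_iInf fun x' => Measure.le_iff.2 fun A hA => ?_
    rw [Measure.smul_apply, smul_eq_mul, mul_comm, ← div_eq_mul_inv]
    exact ENNReal.div_le_of_le_mul' (K.isPrivate j x x' A hA)
  intro A
  have hA := h A
  rw [Measure.smul_apply, smul_eq_mul] at hA ⊢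
  calc K.Q j x A = ENNReal.ofReal (Real.exp (α j))
        * ((ENNReal.ofReal (Real.exp (α j)))⁻¹ * K.Q j x A) := by
        rw [← mul_assoc, ENNReal.mul_inv_cancel hc0 ENNReal.ofReal_ne_top, one_mul]
    _ ≤ _ := by gcongr

theorem Mechanism.floor_real_le (K : Mechanism α Z) (j : Fin d) (x : ℝ) (A : Set (Z j)) :
    (K.floor j).real A ≤ (K.Q j x).real A :=
  ENNReal.toReal_mono (measure_ne_top _ _) (K.floor_le j x A)

theorem Mechanism.abs_real_sub_floor_le (K : Mechanism α Z) (j : Fin d) (x : ℝ) (A : Set (Z j)) :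
    |(K.Q j x).real A - (K.floor j).real A|
      ≤ (Real.exp (α j) - 1) * (K.floor j).real A := by
  rw [abs_of_nonneg (sub_nonneg.2 (K.floor_real_le j x A))]
  have h := K.le_smul_floor j x A
  rw [Measure.smul_apply, smul_eq_mul] at h
  have h := ENNReal.toReal_mono (by finiteness) h
  rw [ENNReal.toReal_mul,
    ENNReal.toReal_ofReal (Real.exp_pos _).le] at h
  simp only [Measure.real]
  linarith

theorem Mechanism.measurable_real (K : Mechanism α Z) (j : Fin d) {A : Set (Z j)}
    (hA : MeasurableSet A) : Measurable fun x => (K.Q j x).real A :=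
  ((K.Q j).measurable_coe hA).ennreal_toReal

instance (K : Mechanism α Z) : IsMarkovKernel K.channel :=
  ⟨fun x => inferInstanceAs (IsProbabilityMeasure (Measure.pi fun j => K.Q j (x j)))⟩

theorem Mechanism.bind_channel_real_box (K : Mechanism α Z)
    {f : EuclideanSpace ℝ (Fin d) → ℝ} (hf : Measurable f) (hf0 : ∀ x, 0 ≤ f x)
    {A : ∀ j, Set (Z j)} (hA : ∀ j, MeasurableSet (A j)) :
    ((densityLaw f).bind K.channel).real (Set.univ.pi A)
      = ∫ x, f x * ∏ j, (K.Q j (x j)).real (A j) := by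
  have hQ : ∀ j, Measurable fun x : EuclideanSpace ℝ (Fin d) => (K.Q j (x j)).real (A j) :=
    fun j => (K.measurable_real j (hA j)).comp (by fun_prop)
  have hbox := MeasurableSet.univ_pi hA
  rw [integral_eq_lintegral_of_nonneg_ae
    (.of_forall fun x => mul_nonneg (hf0 x) (Finset.prod_nonneg fun _ _ => measureReal_nonneg))
    (hf.mul (Finset.measurable_prod _ fun j _ => hQ j)).aestronglyMeasurable, Measure.real,
    Measure.bind_apply hbox K.channel.measurable.aemeasurable, densityLaw,
    lintegral_withDensity_eq_lintegral_mul _ hf.ennreal_ofReal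
      (K.channel.measurable_coe hbox)]
  congr 1
  refine lintegral_congr fun x => ?_
  have hx : K.channel x (Set.univ.pi A) = ∏ j, K.Q j (x j) (A j) := Measure.pi_pi _ _
  rw [Pi.mul_apply, hx, ENNReal.ofReal_mul (hf0 x),
    ENNReal.ofReal_prod_of_nonneg fun _ _ => measureReal_nonneg]
  simp

theorem integral_tensor {γ : Fin d → ℝ → ℝ} :
    ∫ x : EuclideanSpace ℝ (Fin d), ∏ j, γ j (x j) = ∏ j, ∫ u, γ j u := by
  rw [← integral_fintype_prod_volume_eq_prod,
    ← (PiLp.volume_preserving_toLp (Fin d)).integral_comp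
      (MeasurableEquiv.toLp 2 _).measurableEmbedding]

/-- A tensor-product perturbation whose factors integrate to zero is seen through the mechanism
only via the product of the coordinatewise fluctuations `Q j (· | x) - floor j`, so that it moves
the probability of a box by a factor of order `∏ j, (e^{α_j} - 1)`. -/
theorem Mechanism.abs_integral_tensor_le (K : Mechanism α Z) {γ : Fin d → ℝ → ℝ}
    (hγ : ∀ j, Integrable (γ j)) (hγ0 : ∀ j, ∫ u, γ j u = 0)
    {A : ∀ j, Set (Z j)} (hA : ∀ j, MeasurableSet (A j)) :
    |∫ x : EuclideanSpace ℝ (Fin d), ∏ j, (γ j (x j) * (K.Q j (x j)).real (A j))|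
      ≤ (∏ j, (Real.exp (α j) - 1) * ∫ u, |γ j u|) * ∏ j, (K.floor j).real (A j) := by
  rw [integral_tensor (γ := fun j u => γ j u * (K.Q j u).real (A j)), Finset.abs_prod,
    ← Finset.prod_mul_distrib]
  refine Finset.prod_le_prod (fun _ _ => abs_nonneg _) fun j _ => ?_
  have hi : Integrable fun u => γ j u * (K.Q j u).real (A j) :=
    (hγ j).mul_bdd (c := 1) (K.measurable_real j (hA j)).aestronglyMeasurable
      (.of_forall fun u => by
        rw [Real.norm_of_nonneg measureReal_nonneg]; exact measureReal_le_one)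
  have h1 : ∫ u, γ j u * (K.Q j u).real (A j)
      = ∫ u, γ j u * ((K.Q j u).real (A j) - (K.floor j).real (A j)) := by
    -- Subtracting the constant `floor j (A j)` is free because `γ j` integrates to zero.
    simp_rw [mul_sub]
    rw [integral_sub hi ((hγ j).mul_const _), integral_mul_const, hγ0 j, zero_mul, sub_zero]
  rw [h1]
  calc _ ≤ ∫ u, |γ j u| * ((Real.exp (α j) - 1) * (K.floor j).real (A j)) := by
        rw [← Real.norm_eq_abs]
        refine norm_integral_le_of_norm_le ((hγ j).abs.mul_const _) (.of_forall fun u => ?_)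
        rw [norm_mul, Real.norm_eq_abs, Real.norm_eq_abs]
        gcongr
        exact K.abs_real_sub_floor_le j u (A j)
    _ = _ := by rw [integral_mul_const]; ring

theorem isProbabilityMeasure_densityLaw {f : EuclideanSpace ℝ (Fin d) → ℝ}
    (hf : ∫⁻ x, ENNReal.ofReal (f x) = 1) : IsProbabilityMeasure (densityLaw f) :=
  ⟨by rw [densityLaw, withDensity_apply _ MeasurableSet.univ, setLIntegral_univ, hf]⟩

theorem integrable_of_lintegral_ofReal_eq_one {f : EuclideanSpace ℝ (Fin d) → ℝ}
    (hfm : Measurable f) (hf0 : ∀ x, 0 ≤ f x) (hf : ∫⁻ x, ENNReal.ofReal (f x) = 1) :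
    Integrable f :=
  ⟨hfm.aestronglyMeasurable, by
    rw [hasFiniteIntegral_iff_ofReal (.of_forall hf0), hf]; exact ENNReal.one_lt_top⟩

/-- The product of the floor measures lies below every law of the public vector; this turns bounds
relative to the floors into bounds relative to `P₀`. -/
theorem Mechanism.prod_floor_le (K : Mechanism α Z)
    {f : EuclideanSpace ℝ (Fin d) → ℝ} (hf : ∫⁻ x, ENNReal.ofReal (f x) = 1)
    {A : ∀ j, Set (Z j)} (hA : ∀ j, MeasurableSet (A j)) :
    ∏ j, (K.floor j).real (A j) ≤ ((densityLaw f).bind K.channel).real (Set.univ.pi A) := by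
  have hP := isProbabilityMeasure_densityLaw hf
  have h : ENNReal.ofReal (∏ j, (K.floor j).real (A j))
      ≤ ((densityLaw f).bind K.channel) (Set.univ.pi A) := by
    rw [Measure.bind_apply (MeasurableSet.univ_pi hA) K.channel.measurable.aemeasurable]
    calc _ = ∫⁻ _, ENNReal.ofReal (∏ j, (K.floor j).real (A j)) ∂(densityLaw f) := by simp
      _ ≤ _ := by
        refine lintegral_mono fun x => ?_
        have hx : K.channel x (Set.univ.pi A) = ∏ j, K.Q j (x j) (A j) := Measure.pi_pi _ _
        rw [hx, ENNReal.ofReal_prod_of_nonneg fun _ _ => measureReal_nonneg]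
        refine Finset.prod_le_prod' fun j _ => ?_
        rw [ofReal_measureReal]
        exact K.floor_le j (x j) (A j)
  rwa [ENNReal.ofReal_le_iff_le_toReal (measure_ne_top _ _)] at h

/-- The public laws of one vector under the two densities are within a relative distance `δ` on
boxes. -/
theorem Mechanism.abs_real_box_sub_le (K : Mechanism α Z) (hα : ∀ j, 0 ≤ α j)
    {f₀ f₁ : EuclideanSpace ℝ (Fin d) → ℝ} (hm₀ : Measurable f₀) (hm₁ : Measurable f₁)
    (hf₀ : ∀ x, 0 ≤ f₀ x) (hf₁ : ∀ x, 0 ≤ f₁ x)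
    (h₀ : ∫⁻ x, ENNReal.ofReal (f₀ x) = 1) (h₁ : ∫⁻ x, ENNReal.ofReal (f₁ x) = 1)
    {a : ℝ} {γ : Fin d → ℝ → ℝ} (hγ : ∀ j, Integrable (γ j)) (hγ0 : ∀ j, ∫ u, γ j u = 0)
    (hsub : ∀ x, f₁ x - f₀ x = a * ∏ j, γ j (x j))
    {A : ∀ j, Set (Z j)} (hA : ∀ j, MeasurableSet (A j)) :
    |((densityLaw f₁).bind K.channel).real (Set.univ.pi A)
        - ((densityLaw f₀).bind K.channel).real (Set.univ.pi A)|
      ≤ (|a| * ∏ j, (Real.exp (α j) - 1) * ∫ u, |γ j u|)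
        * ((densityLaw f₀).bind K.channel).real (Set.univ.pi A) := by
  have hQ : Measurable fun x : EuclideanSpace ℝ (Fin d) => ∏ j, (K.Q j (x j)).real (A j) :=
    Finset.measurable_prod _ fun j _ => (K.measurable_real j (hA j)).comp (by fun_prop)
  have hi : ∀ f : EuclideanSpace ℝ (Fin d) → ℝ, Integrable f →
      Integrable fun x => f x * ∏ j, (K.Q j (x j)).real (A j) := fun f hf =>
    hf.mul_bdd (c := 1) hQ.aestronglyMeasurable (.of_forall fun x => by
      rw [Real.norm_of_nonneg (Finset.prod_nonneg fun _ _ => measureReal_nonneg)]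
      exact Finset.prod_le_one (fun _ _ => measureReal_nonneg) fun _ _ => measureReal_le_one)
  rw [K.bind_channel_real_box hm₁ hf₁ hA]
  have hfloor := K.prod_floor_le h₀ hA
  rw [K.bind_channel_real_box hm₀ hf₀ hA] at hfloor ⊢
  rw [← integral_sub (hi _ (integrable_of_lintegral_ofReal_eq_one hm₁ hf₁ h₁))
    (hi _ (integrable_of_lintegral_ofReal_eq_one hm₀ hf₀ h₀))]
  have heq : ∀ x : EuclideanSpace ℝ (Fin d), f₁ x * ∏ j, (K.Q j (x j)).real (A j)
      - f₀ x * ∏ j, (K.Q j (x j)).real (A j)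
      = a * ∏ j, (γ j (x j) * (K.Q j (x j)).real (A j)) := fun x => by
    rw [← sub_mul, hsub, Finset.prod_mul_distrib, mul_assoc]
  simp_rw [heq]
  rw [integral_const_mul, abs_mul, mul_assoc]
  have hprod : 0 ≤ ∏ j, (Real.exp (α j) - 1) * ∫ u, |γ j u| :=
    Finset.prod_nonneg fun j _ => mul_nonneg (by linarith [Real.one_le_exp (hα j)])
      (integral_nonneg fun _ => abs_nonneg _)
  gcongr
  exact (K.abs_integral_tensor_le hγ hγ0 hA).trans (by gcongr)

/-- The two-point lower bound for `n` privatised observations under two densities differing by a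
tensor-product perturbation. -/
theorem Mechanism.two_point_publicLaw (K : Mechanism α Z) (hd : 1 ≤ d) (hα : ∀ j, 0 ≤ α j)
    {f₀ f₁ : EuclideanSpace ℝ (Fin d) → ℝ} (hm₀ : Measurable f₀) (hm₁ : Measurable f₁)
    (hf₀ : ∀ x, 0 ≤ f₀ x) (hf₁ : ∀ x, 0 ≤ f₁ x)
    (h₀ : ∫⁻ x, ENNReal.ofReal (f₀ x) = 1) (h₁ : ∫⁻ x, ENNReal.ofReal (f₁ x) = 1)
    {a : ℝ} {γ : Fin d → ℝ → ℝ} (hγ : ∀ j, Integrable (γ j)) (hγ0 : ∀ j, ∫ u, γ j u = 0)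
    (hsub : ∀ x, f₁ x - f₀ x = a * ∏ j, γ j (x j)) (n : ℕ)
    {T : (Fin n → ∀ j, Z j) → ℝ} (hT : Measurable T) (b₀ b₁ : ℝ) :
    ENNReal.ofReal ((b₁ - b₀) ^ 2
        / (1 + Real.exp (n * (|a| * ∏ j, (Real.exp (α j) - 1) * ∫ u, |γ j u|) ^ 2)))
      ≤ ∫⁻ z, ENNReal.ofReal ((T z - b₀) ^ 2) ∂(K.publicLaw n f₀)
        + ∫⁻ z, ENNReal.ofReal ((T z - b₁) ^ 2) ∂(K.publicLaw n f₁) := by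
  have := isProbabilityMeasure_densityLaw h₀
  have := isProbabilityMeasure_densityLaw h₁
  have : Nonempty (Fin d) := ⟨⟨0, hd⟩⟩
  set δ := |a| * ∏ j, (Real.exp (α j) - 1) * ∫ u, |γ j u| with hδdef
  have hδ : 0 ≤ δ := mul_nonneg (abs_nonneg a) <| Finset.prod_nonneg fun j _ =>
    mul_nonneg (by linarith [Real.one_le_exp (hα j)]) (integral_nonneg fun _ => abs_nonneg _)
  set P₀ := (densityLaw f₀).bind K.channel with hP₀
  set P₁ := (densityLaw f₁).bind K.channel with hP₁
  have hbox : ∀ A : ∀ j, Set (Z j), (∀ j, MeasurableSet (A j)) →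
      |P₁.real (Set.univ.pi A) - P₀.real (Set.univ.pi A)| ≤ δ * P₀.real (Set.univ.pi A) :=
    fun A hA => K.abs_real_box_sub_le hα hm₀ hm₁ hf₀ hf₁ h₀ h₁ hγ hγ0 hsub hA
  have hfin : IsFiniteMeasure (ENNReal.ofReal δ • P₀) := P₀.smul_finite ENNReal.ofReal_ne_top
  have hconv : ∀ (P P' : Measure (∀ j, Z j)) [IsFiniteMeasure P] [IsFiniteMeasure P'] s,
      P.real s ≤ P'.real s + δ * P₀.real s → P s ≤ (P' + ENNReal.ofReal δ • P₀) s := by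
    intro P P' _ _ s hs
    rw [Measure.add_apply, Measure.smul_apply, smul_eq_mul, ← ofReal_measureReal (μ := P),
      ← ofReal_measureReal (μ := P'), ← ofReal_measureReal (μ := P₀), ← ENNReal.ofReal_mul hδ,
      ← ENNReal.ofReal_add measureReal_nonneg (mul_nonneg hδ measureReal_nonneg)]
    exact ENNReal.ofReal_le_ofReal hs
  have hle₁ : P₁ ≤ P₀ + ENNReal.ofReal δ • P₀ := le_of_forall_measurable_box fun A hA =>
    hconv P₁ P₀ _ (by linarith [(abs_le.1 (hbox A hA)).2])
  have hle₀ : P₀ ≤ P₁ + ENNReal.ofReal δ • P₀ := le_of_forall_measurable_box fun A hA =>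
    hconv P₀ P₁ _ (by linarith [(abs_le.1 (hbox A hA)).1])
  obtain ⟨u, hu, hud, husq⟩ := exists_withDensity_eq_lintegral_sq_le hδ hle₁ hle₀
  have hpi : (Measure.pi fun _ : Fin n => P₁)
      = (Measure.pi fun _ : Fin n => P₀).withDensity fun z => ∏ i, u (z i) := by
    have : SigmaFinite (P₀.withDensity u) := by rw [← hud]; infer_instance
    rw [hud]
    exact pi_withDensity_eq P₀ hu
  refine two_point_lower_bound (P₁ := Measure.pi fun _ : Fin n => P₁)
    (Finset.measurable_prod _ fun i _ => hu.comp (measurable_pi_apply i)) hpi (Real.exp_pos _).le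
    ?_ hT b₀ b₁
  simp_rw [← Finset.prod_pow]
  have hprod := lintegral_pi_prod (ι := Fin n) P₀ (g := fun _ x => u x ^ 2)
    fun _ => hu.pow_const 2
  refine hprod.trans_le ?_
  calc ∏ _i : Fin n, ∫⁻ x, u x ^ 2 ∂P₀ ≤ ∏ _i : Fin n, ENNReal.ofReal (Real.exp (δ ^ 2)) := by
        refine Finset.prod_le_prod' fun _ _ => husq.trans (ENNReal.ofReal_le_ofReal ?_)
        linarith [Real.add_one_le_exp (δ ^ 2)]
    _ = ENNReal.ofReal (Real.exp (n * δ ^ 2)) := by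
        rw [Finset.prod_const, Finset.card_univ, Fintype.card_fin,
          ← ENNReal.ofReal_pow (Real.exp_pos _).le, ← Real.exp_nat_mul]

end

/-! ### The two densities and the minimax bound -/

theorem exists_forall_norm_le_of_hasCompactSupport {E : Type*} [NormedAddCommGroup E] {f : E → ℝ}
    (hf : HasCompactSupport f) : ∃ R : ℝ, 0 < R ∧ ∀ y, f y ≠ 0 → ‖y‖ ≤ R := by
  obtain ⟨R, hR⟩ := hf.isCompact.isBounded.exists_norm_le
  exact ⟨max R 1, by positivity,
    fun y hy => (hR y (subset_tsupport _ hy)).trans (le_max_left _ _)⟩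

/-- A smooth compactly supported probability density that is constant on a prescribed ball. -/
theorem exists_contDiff_density_const_on_ball (d : ℕ) {R : ℝ} (hR : 0 < R) :
    ∃ (p : EuclideanSpace ℝ (Fin d) → ℝ) (p₀ : ℝ), ContDiff ℝ ∞ p ∧ HasCompactSupport p ∧
      (∀ x, 0 ≤ p x) ∧ ∫ x, p x = 1 ∧ 0 < p₀ ∧ ∀ x, ‖x‖ ≤ R → p x = p₀ := by
  let f : ContDiffBump (0 : EuclideanSpace ℝ (Fin d)) := ⟨R, R + 1, hR, by linarith⟩
  refine ⟨f.normed volume, 1 / ∫ x, f x, f.contDiff_normed, f.hasCompactSupport_normed,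
    fun x => f.nonneg_normed x, f.integral_normed, div_pos one_pos f.integral_pos, fun x hx => ?_⟩
  rw [ContDiffBump.normed_def, f.one_of_mem_closedBall (by simpa [f] using hx)]

theorem integral_comp_inv_smul_sub {d : ℕ} (f : EuclideanSpace ℝ (Fin d) → ℝ) {s : ℝ}
    (hs : 0 < s) (x₀ : EuclideanSpace ℝ (Fin d)) :
    ∫ x, f (s⁻¹ • (x - x₀)) = s ^ d * ∫ x, f x := by
  rw [integral_sub_right_eq_self (fun x => f (s⁻¹ • x)) x₀,
    Measure.integral_comp_inv_smul_of_nonneg _ _ hs.le, finrank_euclideanSpace_fin, smul_eq_mul]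

theorem integral_comp_inv_mul_sub (f : ℝ → ℝ) {s : ℝ} (hs : 0 < s) (u₀ : ℝ) :
    ∫ u, f (s⁻¹ * (u - u₀)) = s * ∫ u, f u := by
  rw [integral_sub_right_eq_self (fun u => f (s⁻¹ * u)) u₀, Measure.integral_comp_mul_left,
    inv_inv, abs_of_pos hs, smul_eq_mul]

theorem mem_holderDensities_of_integral {d : ℕ} {β L : ℝ} {f : EuclideanSpace ℝ (Fin d) → ℝ}
    (hf0 : ∀ x, 0 ≤ f x) (hfi : Integrable f) (hf1 : ∫ x, f x = 1) (hf : IsHolder β L f) :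
    f ∈ holderDensities d β L :=
  ⟨hf0, by rw [← ofReal_integral_eq_lintegral_ofReal hfi (.of_forall hf0), hf1,
    ENNReal.ofReal_one], hf⟩

theorem IsHolder.mono {d : ℕ} {β L L' : ℝ} {f : EuclideanSpace ℝ (Fin d) → ℝ}
    (hf : IsHolder β L f) (hL : L ≤ L') : IsHolder β L' f :=
  ⟨hf.1, fun x y => (hf.2 x y).trans
    (mul_le_mul_of_nonneg_right hL (Real.rpow_nonneg (norm_nonneg _) _))⟩

theorem IsHolder.add {d : ℕ} {β L L' : ℝ} {f g : EuclideanSpace ℝ (Fin d) → ℝ}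
    (hf : IsHolder β L f) (hg : IsHolder β L' g) : IsHolder β (L + L') fun x => f x + g x := by
  refine ⟨hf.1.add hg.1, fun x y => ?_⟩
  rw [show (fun x => f x + g x) = f + g from rfl,
    iteratedFDeriv_add_apply hf.1.contDiffAt hg.1.contDiffAt,
    iteratedFDeriv_add_apply hf.1.contDiffAt hg.1.contDiffAt, add_sub_add_comm, add_mul]
  exact (norm_add_le _ _).trans (add_le_add (hf.2 x y) (hg.2 x y))

/-- Smooth compactly supported functions are Hölder of every order, and rescaling acts on the
Hölder constant by `a h^{-β}`. -/
theorem exists_isHolder_scaled {d : ℕ} {β : ℝ} (hβ : 0 < β) {f : EuclideanSpace ℝ (Fin d) → ℝ}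
    (hf : ContDiff ℝ ∞ f) (hc : HasCompactSupport f) :
    ∃ C : ℝ, 0 ≤ C ∧ ∀ (a h : ℝ) (x₀ : EuclideanSpace ℝ (Fin d)), 0 ≤ a → 0 < h →
      IsHolder β (a * h ^ (-β) * C) fun x => a * f (h⁻¹ • (x - x₀)) := by
  have hspec := holderOrder_spec hβ
  obtain ⟨C, hC0, hC⟩ := exists_norm_iteratedFDeriv_sub_le_rpow hf hc (holderOrder β)
    (θ := β - holderOrder β) (by linarith) (by linarith)
  refine ⟨C, hC0, fun a h x₀ ha hh => ⟨?_, fun x y =>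
    norm_iteratedFDeriv_scaled_sub_le hf hC ha hh x₀ x y⟩⟩
  have : ContDiff ℝ ∞ fun x => a * f (h⁻¹ • (x - x₀)) :=
    contDiff_const.mul (hf.comp (by fun_prop))
  exact this.of_le (by exact_mod_cast le_top)

/-- The two hypotheses: a flat smooth density around `x₀`, and the same density plus a
tensor-product bump of relative width `t` and height of order `t^β`. -/
theorem exists_two_densities {d : ℕ} (hd : 1 ≤ d) {β L : ℝ} (hβ : 0 < β) (hL : 0 < L) :
    ∃ A D : ℝ, 0 < A ∧ ∀ (x₀ : EuclideanSpace ℝ (Fin d)) (t : ℝ), 0 < t → t ≤ 1 →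
      ∃ f₀ ∈ holderDensities d β L, ∃ f₁ ∈ holderDensities d β L,
      ∃ (a : ℝ) (γ : Fin d → ℝ → ℝ), (∀ j, Integrable (γ j)) ∧ (∀ j, ∫ u, γ j u = 0) ∧
        (∀ x, f₁ x - f₀ x = a * ∏ j, γ j (x j)) ∧ f₁ x₀ - f₀ x₀ = A * t ^ β ∧
        |a| * ∏ j, ∫ u, |γ j u| = D * t ^ (β + d) := by
  obtain ⟨φ, hφ, hφc, hφ0, hφ1, hφb⟩ := exists_contDiff_integral_eq_zero
  have hG := contDiff_tensorBump (d := d) hφ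
  have hGc := hasCompactSupport_tensorBump (d := d) hφc
  obtain ⟨R, hR, hGR⟩ := exists_forall_norm_le_of_hasCompactSupport hGc
  obtain ⟨p, p₀, hp, hpc, hpn, hpi, hp0, hpR⟩ := exists_contDiff_density_const_on_ball d hR
  obtain ⟨C, hC, hCp⟩ := exists_isHolder_scaled hβ hp hpc
  obtain ⟨C', hC', hCG⟩ := exists_isHolder_scaled hβ hG hGc
  -- Spreading the base density over scale `s` makes every Hölder constant small.
  obtain ⟨s, hsL, hs1⟩ : ∃ s : ℝ, s ^ (-(d + β)) * (C + C') ≤ L ∧ 1 ≤ s := by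
    have h := (tendsto_rpow_neg_atTop (y := d + β) (by positivity)).mul_const (C + C')
    rw [zero_mul] at h
    exact ((h.eventually_le_const hL).and (Filter.eventually_ge_atTop 1)).exists
  have hs : 0 < s := by linarith
  have hsd : (s ^ d)⁻¹ * s ^ (-β) = s ^ (-(d + β)) := by
    rw [neg_add, Real.rpow_add hs, Real.rpow_neg hs.le (d : ℝ), Real.rpow_natCast]
  set q : ℝ := min p₀ 1 with hq
  have hq0 : 0 < q := lt_min hp0 one_pos
  refine ⟨(s ^ d)⁻¹ * q, q * (∫ u, |φ u|) ^ d, by positivity, fun x₀ t ht ht1 => ?_⟩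
  have hst : 0 < s * t := by positivity
  have htβ : 0 < t ^ β := Real.rpow_pos_of_pos ht β
  have htβ1 : t ^ β ≤ 1 := Real.rpow_le_one ht.le ht1 hβ.le
  set f₀ : EuclideanSpace ℝ (Fin d) → ℝ := fun x => (s ^ d)⁻¹ * p (s⁻¹ • (x - x₀)) with hf₀
  set a : ℝ := (s ^ d)⁻¹ * q * t ^ β with ha
  have ha0 : 0 < a := by positivity
  set g : EuclideanSpace ℝ (Fin d) → ℝ :=
    fun x => a * tensorBump d φ ((s * t)⁻¹ • (x - x₀)) with hg
  have hf₀n : ∀ x, 0 ≤ f₀ x := fun x => mul_nonneg (by positivity) (hpn _)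
  have hf₀i : Integrable f₀ :=
    (((hp.continuous.integrable_of_hasCompactSupport hpc).comp_smul
      (inv_ne_zero hs.ne')).comp_sub_right x₀).const_mul _
  have hgi : Integrable g :=
    (((hG.continuous.integrable_of_hasCompactSupport hGc).comp_smul
      (inv_ne_zero hst.ne')).comp_sub_right x₀).const_mul _
  have hf₀1 : ∫ x, f₀ x = 1 := by
    rw [hf₀, integral_const_mul, integral_comp_inv_smul_sub p hs, hpi, mul_one,
      inv_mul_cancel₀ (by positivity)]
  have hg0 : ∫ x, g x = 0 := by
    have h : ∫ x, tensorBump d φ x = 0 := by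
      unfold tensorBump
      rw [integral_tensor (γ := fun _ => φ), Finset.prod_const, hφ0, Finset.card_univ,
        Fintype.card_fin, zero_pow (by omega)]
    rw [hg, integral_const_mul, integral_comp_inv_smul_sub _ hst, h, mul_zero, mul_zero]
  have hH₀ : IsHolder β ((s ^ d)⁻¹ * s ^ (-β) * C) f₀ := hCp _ s x₀ (by positivity) hs
  have hHg : IsHolder β ((s ^ d)⁻¹ * s ^ (-β) * C') g := by
    refine (hCG a (s * t) x₀ ha0.le hst).mono ?_
    rw [Real.mul_rpow hs.le ht.le]
    have htt : t ^ β * t ^ (-β) = 1 := by rw [← Real.rpow_add ht, add_neg_cancel, Real.rpow_zero]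
    calc a * (s ^ (-β) * t ^ (-β)) * C'
        = (s ^ d)⁻¹ * s ^ (-β) * C' * q * (t ^ β * t ^ (-β)) := by rw [ha]; ring
      _ ≤ (s ^ d)⁻¹ * s ^ (-β) * C' * 1 * 1 := by
        rw [htt]; gcongr; exact min_le_right _ _
      _ = _ := by ring
  have hn : ∀ x, 0 ≤ f₀ x + g x := by
    intro x
    by_cases hx : tensorBump d φ ((s * t)⁻¹ • (x - x₀)) = 0
    · have hgx : g x = 0 := by rw [hg]; simp only [hx, mul_zero]
      rw [hgx, add_zero]
      exact hf₀n x
    · have h1 := hGR _ hx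
      have h2 : s⁻¹ • (x - x₀) = t • ((s * t)⁻¹ • (x - x₀)) := by
        rw [smul_smul]; congr 1; field_simp
      have h3 : ‖s⁻¹ • (x - x₀)‖ ≤ R := by
        rw [h2, norm_smul, Real.norm_of_nonneg ht.le]
        nlinarith [norm_nonneg ((s * t)⁻¹ • (x - x₀))]
      have h4 : f₀ x = (s ^ d)⁻¹ * p₀ := by rw [hf₀]; simp only [hpR _ h3]
      have h5 : |g x| ≤ (s ^ d)⁻¹ * p₀ := by
        rw [hg, abs_mul, abs_of_pos ha0]
        calc _ ≤ a * 1 := by gcongr; exact abs_tensorBump_le_one hφb _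
          _ ≤ (s ^ d)⁻¹ * p₀ * 1 := by rw [ha, mul_one]; gcongr; exact min_le_left _ _
          _ = _ := mul_one _
      linarith [(abs_le.1 h5).1]
  have hLsum : (s ^ d)⁻¹ * s ^ (-β) * C + (s ^ d)⁻¹ * s ^ (-β) * C' ≤ L := by
    rw [← mul_add, hsd]; exact hsL
  have hL' : (s ^ d)⁻¹ * s ^ (-β) * C ≤ L :=
    (le_add_of_nonneg_right (by positivity)).trans hLsum
  refine ⟨f₀, mem_holderDensities_of_integral hf₀n hf₀i hf₀1 (hH₀.mono hL'),
    fun x => f₀ x + g x, mem_holderDensities_of_integral hn (hf₀i.add hgi)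
      (by rw [integral_add hf₀i hgi, hf₀1, hg0, add_zero]) ((hH₀.add hHg).mono hLsum),
    a, fun j u => φ ((s * t)⁻¹ * (u - x₀ j)), fun j => ?_, fun j => ?_, fun x => ?_, ?_, ?_⟩
  · exact ((hφ.continuous.integrable_of_hasCompactSupport hφc).comp_mul_left'
      (inv_ne_zero hst.ne')).comp_sub_right (x₀ j)
  · rw [integral_comp_inv_mul_sub φ hst, hφ0, mul_zero]
  · simp [hg, tensorBump]
  · simp [hg, tensorBump, hφ1, ha]
  · have h : ∀ j, ∫ u, |φ ((s * t)⁻¹ * (u - x₀ j))| = s * t * ∫ u, |φ u| :=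
      fun j => integral_comp_inv_mul_sub (fun u => |φ u|) hst (x₀ j)
    simp_rw [h]
    rw [Finset.prod_const, Finset.card_univ, Fintype.card_fin, abs_of_pos ha0, ha,
      Real.rpow_add ht, Real.rpow_natCast]
    field_simp
    ring

end CLDP

open CLDP in
theorem mainTheorem4 (d : ℕ) (hd : 1 ≤ d) (β L κ : ℝ) (hβ : 0 < β) (hL : 0 < L) (hκ : 0 < κ) :
    ∃ c : ℝ, 0 < c ∧
      ∀ (n : ℕ) (α : Fin d → ℝ) (x₀ : EuclideanSpace ℝ (Fin d)),
        1 ≤ n → (∀ j, 0 < α j) → κ ≤ (n : ℝ) * ∏ j, (Real.exp (α j) - 1) ^ 2 →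
        ∀ (Z : Fin d → Type*) [∀ j, TopologicalSpace (Z j)] [∀ j, PolishSpace (Z j)]
          [∀ j, MeasurableSpace (Z j)] [∀ j, BorelSpace (Z j)],
          ENNReal.ofReal
              (c * ((n : ℝ) * ∏ j, (Real.exp (α j) - 1) ^ 2) ^ (-(β / (β + (d : ℝ)))))
            ≤ CLDP.minimaxRisk α Z β L n x₀ := by
  obtain ⟨A, D, hA, hAD⟩ := exists_two_densities hd hβ hL
  have hβd : 0 < β + d := by positivity
  refine ⟨A ^ 2 * κ ^ (β / (β + d)) / (1 + Real.exp (κ * D ^ 2)) / 2, by positivity, ?_⟩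
  intro n α x₀ hn hα hN Z _ _ _ _
  set N : ℝ := (n : ℝ) * ∏ j, (Real.exp (α j) - 1) ^ 2 with hNdef
  have hN0 : 0 < N := hκ.trans_le hN
  have hr0 : 0 < κ / N := by positivity
  -- The width `t` makes the total information `N D² t^{2 (β + d)}` equal to `κ D²`.
  set t : ℝ := (κ / N) ^ (1 / (2 * (β + d))) with ht
  have ht0 : 0 < t := Real.rpow_pos_of_pos hr0 _
  have ht1 : t ≤ 1 := Real.rpow_le_one hr0.le ((div_le_one hN0).2 hN) (by positivity)
  have ht2 : (t ^ (β + d)) ^ 2 = κ / N := by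
    rw [← Real.rpow_natCast, ← Real.rpow_mul ht0.le, ht, ← Real.rpow_mul hr0.le]
    conv_rhs => rw [← Real.rpow_one (κ / N)]
    congr 1
    push_cast
    field_simp
  have ht3 : (t ^ β) ^ 2 = κ ^ (β / (β + d)) * N ^ (-(β / (β + d))) := by
    rw [← Real.rpow_natCast, ← Real.rpow_mul ht0.le, ht, ← Real.rpow_mul hr0.le,
      Real.rpow_neg hN0.le, ← div_eq_mul_inv, ← Real.div_rpow hκ.le hN0.le]
    congr 1
    push_cast
    field_simp
  obtain ⟨f₀, hf₀, f₁, hf₁, a, γ, hγ, hγ0, hsub, hdiff, hprod⟩ := hAD x₀ t ht0 ht1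
  refine le_iInf fun K => le_iInf fun T => le_iInf fun hT => ?_
  have hinfo : n * (|a| * ∏ j, (Real.exp (α j) - 1) * ∫ u, |γ j u|) ^ 2 = κ * D ^ 2 := by
    rw [Finset.prod_mul_distrib, mul_left_comm, hprod, mul_pow, mul_pow, ht2, ← Finset.prod_pow,
      ← mul_assoc, ← hNdef]
    field_simp
  have h := K.two_point_publicLaw hd (fun j => (hα j).le) hf₀.2.2.1.continuous.measurable
    hf₁.2.2.1.continuous.measurable hf₀.1 hf₁.1 hf₀.2.1 hf₁.2.1 hγ hγ0 hsub n hT (f₀ x₀) (f₁ x₀)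
  rw [hinfo, hdiff, mul_pow, ht3] at h
  set S := ⨆ f ∈ holderDensities d β L,
      ∫⁻ z, ENNReal.ofReal ((T z - f x₀) ^ 2) ∂(K.publicLaw n f) with hS
  have hS₀ : _ ≤ S := le_iSup₂ (f := fun f (_ : f ∈ holderDensities d β L) =>
    ∫⁻ z, ENNReal.ofReal ((T z - f x₀) ^ 2) ∂(K.publicLaw n f)) f₀ hf₀
  have hS₁ : _ ≤ S := le_iSup₂ (f := fun f (_ : f ∈ holderDensities d β L) =>
    ∫⁻ z, ENNReal.ofReal ((T z - f x₀) ^ 2) ∂(K.publicLaw n f)) f₁ hf₁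
  have h2 := h.trans (add_le_add hS₀ hS₁)
  rw [← two_mul] at h2
  have h3 := ENNReal.div_le_of_le_mul' h2
  rw [← ENNReal.ofReal_ofNat 2, ← ENNReal.ofReal_div_of_pos two_pos] at h3
  refine le_trans (ENNReal.ofReal_le_ofReal (le_of_eq ?_)) h3
  ring
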